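/- For a permutation $\sigma$ of $\{1,\dots,n\}$ let $\mathrm{wex}(\sigma)$ be the number of $i$ with $\sigma(i)\ge i$, and let $\mathrm{cro}(\sigma)$ be the number of pairs $(i,k)$ with $i<k\le\sigma(i)<\sigma(k)$ or $\sigma(i)<\sigma(k)<i<k$. Let $y,q$ be elements of a field $K$ (for instance indeterminates, i.e. the generators of $K=\mathbb{Q}(y,q)$). Then, if $q\neq 1$, for every $n\ge 0$, $$\sum_{\sigma\in\mathfrak S_n} y^{\mathrm{wex}(\sigma)}q^{\mathrm{cro}(\sigma)}=\frac1{(1-q)^n}\sum_{k=0}^n(-1)^k\left(\sum_{j=0}^{n-k}y^j\Big(\tbinom nj\tbinom n{j+k}-\tbinom n{j-1}\tbinom n{j+k+1}\Big)\right)\left(\sum_{i=0}^k y^iq^{i(k+1-i)}\right),$$ where $\binom{n}{-1}=0$. Moreover, for all $y,q\in K$, the left-hand side is the $n$-th moment of the $q$-Laguerre polynomials $\tilde L_n\in K[x]$ of Kasraoui, Stanton and Zeng, defined by $\tilde L_{-1}=0$, $\tilde L_0=1$ and $$x\tilde L_n=\tilde L_{n+1}+([n]_q+y[n+1]_q)\tilde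 L_n+y[n]_q^2\tilde L_{n-1},\qquad [n]_q=1+q+\dots+q^{n-1}.$$ That is, there is exactly one $K$-linear functional $\ell$ on $K[x]$ with $\ell(1)=1$ and $\ell(\tilde L_m\tilde L_n)=0$ for all $m\ne n$, and it satisfies $\ell(x^n)=\sum_{\sigma\in\mathfrak S_n} y^{\mathrm{wex}(\sigma)}q^{\mathrm{cro}(\sigma)}$ for all $n\ge 0$. -/

import Mathlib

open scoped Polynomial

/-- The number of weak exceedances of a permutation: the indices `i` with `i ≤ σ i`.
Permutations of `{1, …, n}` are modelled by permutations of the ordered set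
`Fin n = {0, …, n - 1}`; only the order of the labels matters. -/
def wex {n : ℕ} (σ : Equiv.Perm (Fin n)) : ℕ :=
  (Finset.univ.filter fun i : Fin n => i ≤ σ i).card

/-- The number of crossings of a permutation: the pairs `(i, k)` with
`i < k ≤ σ i < σ k` or `σ i < σ k < i < k`. -/
def cro {n : ℕ} (σ : Equiv.Perm (Fin n)) : ℕ :=
  (Finset.univ.filter fun p : Fin n × Fin n =>
    (p.1 < p.2 ∧ p.2 ≤ σ p.1 ∧ σ p.1 < σ p.2) ∨
    (σ p.1 < σ p.2 ∧ σ p.2 < p.1 ∧ p.1 < p.2)).card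

/-- The binomial coefficient `n` choose `j - 1`, which is zero for `j = 0`. -/
def choosePred (n : ℕ) : ℕ → ℕ
  | 0 => 0
  | j + 1 => n.choose j

/-- The `q`-integer `[n]_q = 1 + q + ⋯ + q ^ (n - 1)`. -/
def qInt {K : Type*} [Field K] (q : K) (n : ℕ) : K :=
  ∑ i ∈ Finset.range n, q ^ i

/-- The `q`-Laguerre polynomials of Kasraoui, Stanton and Zeng: `L 0 = 1` and
`x * L n = L (n + 1) + ([n]_q + y * [n + 1]_q) * L n + y * [n]_q ^ 2 * L (n - 1)`,
where `L (-1) = 0`. -/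
noncomputable def qLaguerre {K : Type*} [Field K] (y q : K) : ℕ → K[X]
  | 0 => 1
  | 1 => Polynomial.X - Polynomial.C (qInt q 0 + y * qInt q 1)
  | n + 2 =>
      (Polynomial.X - Polynomial.C (qInt q (n + 1) + y * qInt q (n + 2))) * qLaguerre y q (n + 1)
        - Polynomial.C (y * qInt q (n + 1) ^ 2) * qLaguerre y q n

/-- A normalized linear functional on polynomials for which the members of the sequence `P`
are pairwise orthogonal. The moments of `P` are the values of this functional at the
powers of the variable. -/
def IsMomentFunctional {K : Type*} [Field K] (P : ℕ → K[X]) (ℓ : K[X] →ₗ[K] K) : Prop :=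
  ℓ 1 = 1 ∧ ∀ m n : ℕ, m ≠ n → ℓ (P m * P n) = 0

/-! All three quantities are identified with `T n 0`, where `T n h` is the `motzkinTable` with level
weights `[h] + y[h+1]` and down weights `y[h]^2`.

Permutations: build the graph of a permutation as a rook placement, enlarging the `n × n` board by
row `n` and then column `n`. With `k` rooks placed there are `h = n - k` open rows and as many open
columns. A rook in the new row contributes `[h]` in total and one in the new column contributes `y`
times the `q`-integer of the number of open rows, so these sums obey the Motzkin recurrence
(`rookSum_eq_motzkinTable`).

Moments: iterating the three-term recurrence gives `X^n = ∑ T n h * L h`. A normalized orthogonal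
functional sends `L h` to `0` for `h > 0`, so the moment is `T n 0`.

Closed formula: after scaling by `1 - q` the weights become `1 + y - q^h (1 + yq)` and `y (1 -
q^h)^2`. Dropping the powers of `q` leaves constant weights `1 + y` and `y`, whose paths are counted
by `ballotSum`. The change of basis between the two families of orthogonal polynomials has explicit
coefficients `connCoeff`, built from products of two `q`-binomials. Composing gives
`pow_mul_motzkinTable`; at height `0` the `q`-binomials are `1`, which leaves the inner sums of the
theorem. -/

/-! ### Weighted Motzkin paths -/

/-- The entry at `(n, h)` of the Motzkin table with level weights `b` and down weights `lam`: the
weighted count of Motzkin paths of length `n` from height `0` to height `h`. -/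
def motzkinTable {K : Type*} [Field K] (b lam : ℕ → K) : ℕ → ℕ → K
  | 0, 0 => 1
  | 0, _ + 1 => 0
  | n + 1, 0 => b 0 * motzkinTable b lam n 0 + lam 1 * motzkinTable b lam n 1
  | n + 1, h + 1 => motzkinTable b lam n h + b (h + 1) * motzkinTable b lam n (h + 1)
      + lam (h + 2) * motzkinTable b lam n (h + 2)

theorem motzkinTable_eq_zero {K : Type*} [Field K] (b lam : ℕ → K) (n h : ℕ) (hn : n < h) :
    motzkinTable b lam n h = 0 := by
  induction n generalizing h with
  | zero => obtain ⟨h, rfl⟩ := Nat.exists_eq_succ_of_ne_zero (by omega : h ≠ 0); rfl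
  | succ n ih =>
    obtain ⟨h, rfl⟩ := Nat.exists_eq_succ_of_ne_zero (by omega : h ≠ 0)
    rw [motzkinTable, ih h (by omega), ih (h + 1) (by omega), ih (h + 2) (by omega)]
    ring

/-! ### `q`-binomials and connection coefficients -/

/-- The `q`-binomial coefficient `p + h` choose `h`. -/
def qBinom {K : Type*} [Field K] (q : K) : ℕ → ℕ → K
  | 0, _ => 1
  | _ + 1, 0 => 1
  | p + 1, h + 1 => qBinom q p (h + 1) + q ^ (p + 1) * qBinom q (p + 1) h

/-- Absorption in a form free of division, so it also holds when `q` is a root of unity. With the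
`q`-Pascal rule it is all that is used about `q`-binomials. -/
theorem qBinom_absorb {K : Type*} [Field K] (q : K) (p h : ℕ) :
    (1 - q ^ (h + 1)) * qBinom q p (h + 1) = (1 - q ^ (p + 1)) * qBinom q (p + 1) h := by
  induction p generalizing h with
  | zero =>
    induction h with
    | zero => simp [qBinom]
    | succ h ih =>
      rw [qBinom.eq_3 q 0 h]
      simp only [qBinom.eq_1] at *
      linear_combination q * ih
  | succ p ihp =>
    induction h with
    | zero =>
      have h1 := ihp 0
      rw [qBinom] at h1 ⊢
      simp only [qBinom] at h1 ⊢
      linear_combination h1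
    | succ h ih =>
      have h1 := ihp (h + 1)
      rw [qBinom.eq_3 q (p + 1) h, qBinom.eq_3 q p (h + 1)]
      linear_combination h1 + q ^ (p + 2) * ih

theorem qBinom_zero_right {K : Type*} [Field K] (q : K) (p : ℕ) : qBinom q p 0 = 1 := by
  cases p <;> simp [qBinom]

/-- The term indexed by `(p, r)` of the connection coefficients. -/
def connTerm {K : Type*} [Field K] (y q : K) (h p r : ℕ) : K :=
  y ^ p * q ^ (p * (r + 1)) * qBinom q p h * qBinom q r h

/-- The connection coefficients, up to sign: `connSum y q m h` is the coefficient between the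
Chebyshev-like polynomial of degree `h + m` and the rescaled `q`-Laguerre polynomial of
degree `h`. -/
def connSum {K : Type*} [Field K] (y q : K) (m h : ℕ) : K :=
  ∑ x ∈ Finset.HasAntidiagonal.antidiagonal m, connTerm y q h x.1 x.2

/-- The connection recurrence already holds term by term in `(p, r)`, so no cancellation between
different terms of an antidiagonal is needed. -/
theorem connTerm_succ {K : Type*} [Field K] (y q : K) (h p r : ℕ) :
    connTerm y q (h + 1) (p + 1) (r + 1) = connTerm y q h (p + 1) (r + 1)
      + q ^ (h + 1) * connTerm y q (h + 1) (p + 1) r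
      + q ^ (h + 1) * (y * q) * connTerm y q (h + 1) p (r + 1)
      + y * (1 - q ^ (h + 2)) ^ 2 * connTerm y q (h + 2) p r - y * connTerm y q (h + 1) p r := by
  unfold connTerm
  have e1 := qBinom_absorb q p (h + 1)
  have e2 := qBinom_absorb q r (h + 1)
  have f1 := qBinom_absorb q p h
  have f2 := qBinom_absorb q r h
  have g1 := qBinom.eq_3 q p h
  have g2 := qBinom.eq_3 q r h
  generalize qBinom q (p + 1) (h + 1) = a at *
  generalize qBinom q (r + 1) (h + 1) = b at *
  generalize qBinom q p (h + 1) = a' at *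
  generalize qBinom q r (h + 1) = b' at *
  generalize qBinom q (p + 1) h = a'' at *
  generalize qBinom q (r + 1) h = b'' at *
  generalize qBinom q p (h + 1 + 1) = c at *
  generalize qBinom q r (h + 1 + 1) = d at *
  have hcd : (1 - q ^ (h + 2)) ^ 2 * (c * d)
      = (1 - q ^ (p + 1)) * (1 - q ^ (r + 1)) * (a * b) := by
    linear_combination (1 - q ^ (h + 2)) * d * e1 + (1 - q ^ (p + 1)) * a * e2
  have hab : q ^ (p + 1) * q ^ (r + 1) * (a'' * b'') = (a - a') * (b - b') := by
    rw [g1, g2]; ring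
  -- Pascal and absorption combined: the ratio of two `q`-binomials with the same lower index and
  -- consecutive upper indices.
  have h1 : (1 - q ^ (p + 1)) * a = a' * (1 - q ^ (p + 1) * q ^ (h + 1)) := by
    linear_combination (1 - q ^ (p + 1)) * g1 - q ^ (p + 1) * f1
  have h2 : (1 - q ^ (r + 1)) * b = b' * (1 - q ^ (r + 1) * q ^ (h + 1)) := by
    linear_combination (1 - q ^ (r + 1)) * g2 - q ^ (r + 1) * f2
  -- The claim with the common factor `y ^ (p + 1) * q ^ (p * (r + 1))` removed.
  have core : q ^ (p + 1) * q ^ (r + 1) * (a * b) = q ^ (p + 1) * q ^ (r + 1) * (a'' * b'')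
      + q ^ (h + 1) * (q ^ (r + 1) * a * b' + q ^ (p + 1) * a' * b)
      + (1 - q ^ (h + 2)) ^ 2 * (c * d) - a' * b' := by
    rw [hcd, hab]
    linear_combination - b * h1 - a * h2
  linear_combination y ^ (p + 1) * q ^ (p * (r + 1)) * core

theorem connTerm_succ_zero {K : Type*} [Field K] (y q : K) (h p : ℕ) :
    connTerm y q (h + 1) (p + 1) 0 = connTerm y q h (p + 1) 0
      + q ^ (h + 1) * (y * q) * connTerm y q (h + 1) p 0 := by
  have f1 := qBinom_absorb q p h
  unfold connTerm
  rw [qBinom.eq_3 q p h]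
  simp only [qBinom]
  linear_combination (y ^ (p + 1) * q ^ (p + 1)) * f1

theorem connTerm_zero_succ {K : Type*} [Field K] (y q : K) (h r : ℕ) :
    connTerm y q (h + 1) 0 (r + 1) = connTerm y q h 0 (r + 1)
      + q ^ (h + 1) * connTerm y q (h + 1) 0 r := by
  have f1 := qBinom_absorb q r h
  unfold connTerm
  rw [qBinom.eq_3 q r h]
  simp only [qBinom]
  linear_combination f1

/-- Sums a termwise recurrence over `p + r = m + 2`. The two ends of the antidiagonal obey shorter
recurrences: each supplies the end term missing from one of the two sums over `p + r = m + 1`. -/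
theorem sum_antidiagonal_of_recurrence {K : Type*} [Field K] (f g u : ℕ → ℕ → K) (α β γ δ : K)
    (hss : ∀ p r, f (p + 1) (r + 1) = g (p + 1) (r + 1) + α * f (p + 1) r + β * f p (r + 1)
      + γ * u p r - δ * f p r)
    (hs0 : ∀ p, f (p + 1) 0 = g (p + 1) 0 + β * f p 0)
    (h0s : ∀ r, f 0 (r + 1) = g 0 (r + 1) + α * f 0 r) (m : ℕ) :
    ∑ x ∈ Finset.HasAntidiagonal.antidiagonal (m + 2), f x.1 x.2
      = ∑ x ∈ Finset.HasAntidiagonal.antidiagonal (m + 2), g x.1 x.2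
        + (α + β) * ∑ x ∈ Finset.HasAntidiagonal.antidiagonal (m + 1), f x.1 x.2
        + γ * ∑ x ∈ Finset.HasAntidiagonal.antidiagonal m, u x.1 x.2
        - δ * ∑ x ∈ Finset.HasAntidiagonal.antidiagonal m, f x.1 x.2 := by
  have h2 : ∀ v : ℕ → ℕ → K, ∑ x ∈ Finset.HasAntidiagonal.antidiagonal (m + 2), v x.1 x.2
      = v 0 (m + 2) + (v (m + 2) 0
        + ∑ x ∈ Finset.HasAntidiagonal.antidiagonal m, v (x.1 + 1) (x.2 + 1)) := by
    intro v
    rw [Finset.Nat.sum_antidiagonal_succ, Finset.Nat.sum_antidiagonal_succ']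
  have ha := Finset.Nat.sum_antidiagonal_succ (n := m) (f := fun x : ℕ × ℕ => f x.1 x.2)
  have hb := Finset.Nat.sum_antidiagonal_succ' (n := m) (f := fun x : ℕ × ℕ => f x.1 x.2)
  simp only at ha hb
  rw [h2, h2, add_mul]
  nth_rewrite 1 [ha]
  rw [hb, hs0, h0s]
  simp only [hss, Finset.sum_add_distrib, Finset.sum_sub_distrib, ← Finset.mul_sum]
  ring

theorem connSum_zero {K : Type*} [Field K] (y q : K) (h : ℕ) : connSum y q 0 h = 1 := by
  simp [connSum, connTerm, qBinom]

theorem connSum_one_zero {K : Type*} [Field K] (y q : K) : connSum y q 1 0 = 1 + y * q := by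
  simp [connSum, connTerm, qBinom, Finset.Nat.antidiagonal_succ]

theorem connSum_one_succ {K : Type*} [Field K] (y q : K) (h : ℕ) :
    connSum y q 1 (h + 1) = connSum y q 1 h + q ^ (h + 1) * (1 + y * q) := by
  have h1 := connTerm_succ_zero y q h 0
  have h2 := connTerm_zero_succ y q h 0
  simp only [connSum, Finset.Nat.antidiagonal_succ, Finset.Nat.antidiagonal_zero]
  simp only [zero_add] at h1 h2
  simp [h1, h2]
  simp [connTerm, qBinom]
  ring

theorem connSum_succ_succ {K : Type*} [Field K] (y q : K) (m h : ℕ) :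
    connSum y q (m + 2) (h + 1) = connSum y q (m + 2) h
      + q ^ (h + 1) * (1 + y * q) * connSum y q (m + 1) (h + 1)
      + y * (1 - q ^ (h + 2)) ^ 2 * connSum y q m (h + 2) - y * connSum y q m (h + 1) := by
  have := sum_antidiagonal_of_recurrence _ _ _ _ _ _ _ (connTerm_succ y q h)
    (connTerm_succ_zero y q h) (connTerm_zero_succ y q h) m
  simp only [connSum]
  rw [this]
  ring

theorem connSum_succ_zero {K : Type*} [Field K] (y q : K) (m : ℕ) :
    connSum y q (m + 2) 0 = (1 + y * q) * connSum y q (m + 1) 0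
      + y * (1 - q) ^ 2 * connSum y q m 1 - y * connSum y q m 0 := by
  have hb : ∀ p, (1 - q) * qBinom q p 1 = 1 - q ^ (p + 1) := by
    intro p
    have := qBinom_absorb q p 0
    rw [qBinom_zero_right] at this
    simpa using this
  -- At height `0` nothing arrives from below, hence `g = 0`.
  have := sum_antidiagonal_of_recurrence (connTerm y q 0) (fun _ _ => 0) (connTerm y q 1)
    1 (y * q) (y * (1 - q) ^ 2) y
    (by
      intro p r
      have h1 : (1 - q) ^ 2 * (qBinom q p 1 * qBinom q r 1)
          = (1 - q ^ (p + 1)) * (1 - q ^ (r + 1)) := by rw [← hb, ← hb]; ring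
      simp only [connTerm, qBinom_zero_right]
      linear_combination (- y ^ (p + 1) * q ^ (p * (r + 1))) * h1)
    (by intro p; simp only [connTerm, qBinom_zero_right]; ring)
    (by intro p; simp only [connTerm, qBinom_zero_right]; ring) m
  simp only [connSum]
  rw [this]
  simp

/-- The coefficients of the Chebyshev-like polynomial of degree `k` in the basis of rescaled
`q`-Laguerre polynomials. -/
def connCoeff {K : Type*} [Field K] (y q : K) (k h : ℕ) : K :=
  if h ≤ k then (-1) ^ (k - h) * connSum y q (k - h) h else 0

theorem connCoeff_of_lt {K : Type*} [Field K] (y q : K) {k h : ℕ} (hk : k < h) :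
    connCoeff y q k h = 0 := if_neg (by omega)

theorem connCoeff_add {K : Type*} [Field K] (y q : K) (m h : ℕ) :
    connCoeff y q (h + m) h = (-1) ^ m * connSum y q m h := by
  simp [connCoeff]

theorem connCoeff_one_zero {K : Type*} [Field K] (y q : K) :
    connCoeff y q 1 0 = - (1 + y * q) := by
  have := connCoeff_add y q 1 0
  rw [connSum_one_zero] at this
  rw [this]; ring

theorem connCoeff_self {K : Type*} [Field K] (y q : K) (h : ℕ) : connCoeff y q h h = 1 := by
  have := connCoeff_add y q 0 h
  rw [connSum_zero] at this
  simpa using this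

theorem connCoeff_succ_zero {K : Type*} [Field K] (y q : K) (k : ℕ) :
    connCoeff y q (k + 2) 0 = - (1 + y * q) * connCoeff y q (k + 1) 0
      + y * (1 - q) ^ 2 * connCoeff y q (k + 1) 1 - y * connCoeff y q k 0 := by
  have h1 := connCoeff_add y q (k + 2) 0
  have h2 := connCoeff_add y q (k + 1) 0
  have h3 := connCoeff_add y q k 0
  have h4 := connCoeff_add y q k 1
  rw [zero_add] at h1 h2 h3
  rw [add_comm 1 k] at h4
  rw [h1, h2, h3, h4, connSum_succ_zero]
  ring

theorem connCoeff_one_succ {K : Type*} [Field K] (y q : K) (h : ℕ) :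
    connCoeff y q 1 (h + 1) = connCoeff y q 0 h
      - q ^ (h + 1) * (1 + y * q) * connCoeff y q 0 (h + 1)
      + y * (1 - q ^ (h + 2)) ^ 2 * connCoeff y q 0 (h + 2) := by
  rw [connCoeff_of_lt y q (by omega : 0 < h + 1), connCoeff_of_lt y q (by omega : 0 < h + 2)]
  cases h with
  | zero => simp [connCoeff_self]
  | succ h =>
    rw [connCoeff_of_lt y q (by omega : 1 < h + 1 + 1), connCoeff_of_lt y q (by omega : 0 < h + 1)]
    simp

/-- Obtained by expanding `x * U (k + 1)` in two ways, where `U` has the constant recurrence weights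
`1 + y`, `y` and `connCoeff` expands `U` in the rescaled `q`-Laguerre basis; the two terms with `1 +
y` cancel. -/
theorem connCoeff_succ_succ {K : Type*} [Field K] (y q : K) (k h : ℕ) :
    connCoeff y q (k + 2) (h + 1) = connCoeff y q (k + 1) h
      - q ^ (h + 1) * (1 + y * q) * connCoeff y q (k + 1) (h + 1)
      + y * (1 - q ^ (h + 2)) ^ 2 * connCoeff y q (k + 1) (h + 2)
      - y * connCoeff y q k (h + 1) := by
  -- For `k < h` everything vanishes except when `h = k + 1`, where the leading coefficients on both
  -- sides are `1`.
  rcases lt_or_ge k h with hk | hk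
  · rw [connCoeff_of_lt y q (by omega : k < h + 1),
      connCoeff_of_lt y q (by omega : k + 1 < h + 1), connCoeff_of_lt y q (by omega : k + 1 < h + 2)]
    rcases lt_or_ge (k + 1) h with hk' | hk'
    · rw [connCoeff_of_lt y q hk', connCoeff_of_lt y q (by omega : k + 2 < h + 1)]
      simp
    · obtain rfl : h = k + 1 := by omega
      simp [connCoeff_self]
  · obtain ⟨m, rfl⟩ := Nat.exists_eq_add_of_le hk
    have h1 := connCoeff_add y q (m + 1) (h + 1)
    have h2 := connCoeff_add y q (m + 1) h
    have h3 := connCoeff_add y q m (h + 1)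
    rw [show h + 1 + (m + 1) = h + m + 2 by ring] at h1
    rw [show h + (m + 1) = h + m + 1 by ring] at h2
    rw [show h + 1 + m = h + m + 1 by ring] at h3
    rw [h1, h2, h3]
    cases m with
    | zero =>
      rw [connCoeff_of_lt y q (by omega : h + 0 + 1 < h + 2),
        connCoeff_of_lt y q (by omega : h + 0 < h + 1), connSum_zero, zero_add, connSum_one_succ]
      ring
    | succ m =>
      have h4 := connCoeff_add y q m (h + 2)
      have h5 := connCoeff_add y q m (h + 1)
      rw [show h + 2 + m = h + (m + 1) + 1 by ring] at h4
      rw [show h + 1 + m = h + (m + 1) by ring] at h5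
      rw [h4, h5, connSum_succ_succ]
      ring

/-! ### Paths with constant weights -/

/-- The summand of the ballot-type numbers `ballotSum`. -/
def ballotTerm {K : Type*} [Field K] (n k j : ℕ) : K :=
  (n.choose j : K) * (n.choose (j + k) : K) -
    (choosePred n j : K) * (n.choose (j + k + 1) : K)

/-- The number of prefixes of length `n` and final height `k` of Motzkin paths with weight
`1 + y` on level steps and `y` on down steps. -/
def ballotSum {K : Type*} [Field K] (y : K) (n k : ℕ) : K :=
  ∑ j ∈ Finset.range (n + 1), y ^ j * ballotTerm n k j

theorem ballotTerm_eq_zero {K : Type*} [Field K] {n k j : ℕ} (h : n < j + k) :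
    (ballotTerm n k j : K) = 0 := by
  simp [ballotTerm, Nat.choose_eq_zero_of_lt h, Nat.choose_eq_zero_of_lt (Nat.lt_succ_of_lt h)]

theorem ballotSum_eq_sum_range {K : Type*} [Field K] (y : K) {n k N : ℕ} (h : n < N + k) :
    ballotSum y n k = ∑ j ∈ Finset.range N, y ^ j * ballotTerm n k j := by
  rcases le_total N (n + 1) with hN | hN
  · refine (Finset.sum_subset (Finset.range_mono hN) fun j _ hj => ?_).symm
    rw [ballotTerm_eq_zero (by simp at hj; omega), mul_zero]
  · refine Finset.sum_subset (Finset.range_mono hN) fun j _ hj => ?_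
    rw [ballotTerm_eq_zero (by simp at hj; omega), mul_zero]

theorem ballotSum_eq_zero {K : Type*} [Field K] (y : K) {n k : ℕ} (h : n < k) :
    ballotSum y n k = 0 := by
  rw [ballotSum_eq_sum_range y (N := 0) (by omega)]; simp

theorem choosePred_succ (n j : ℕ) : choosePred n (j + 1) = n.choose j := rfl

theorem succ_choose_eq_choosePred_add (n j : ℕ) :
    (n + 1).choose j = choosePred n j + n.choose j := by
  cases j with
  | zero => simp [choosePred]
  | succ j => rw [choosePred_succ, Nat.choose_succ_succ']

theorem ballotTerm_succ_zero {K : Type*} [Field K] (n j : ℕ) :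
    (ballotTerm (n + 1) 0 (j + 1) : K) = ballotTerm n 0 (j + 1) + ballotTerm n 0 j
      + ballotTerm n 1 j := by
  simp only [ballotTerm, choosePred_succ, Nat.add_zero, Nat.choose_succ_succ' n,
    succ_choose_eq_choosePred_add n j]
  push_cast
  ring

/-- Pascal's rule in every binomial. Up steps and level steps of weight `1` keep `j`; down steps and
level steps of weight `y` raise it by one. -/
theorem ballotTerm_succ_succ {K : Type*} [Field K] (n k j : ℕ) :
    (ballotTerm (n + 1) (k + 1) (j + 1) : K) = ballotTerm n k (j + 1)
      + ballotTerm n (k + 1) (j + 1) + ballotTerm n (k + 1) j + ballotTerm n (k + 2) j := by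
  simp only [ballotTerm, choosePred_succ,
    show j + 1 + (k + 1) = (j + k + 1) + 1 by ring, show j + (k + 1) = j + k + 1 by ring,
    show j + 1 + k = j + k + 1 by ring, show j + (k + 2) = j + k + 1 + 1 by ring,
    Nat.choose_succ_succ' n, succ_choose_eq_choosePred_add n j]
  push_cast
  ring

theorem ballotSum_succ_zero {K : Type*} [Field K] (y : K) (n : ℕ) :
    ballotSum y (n + 1) 0 = (1 + y) * ballotSum y n 0 + y * ballotSum y n 1 := by
  rw [add_mul, one_mul, ballotSum]
  nth_rewrite 1 [ballotSum_eq_sum_range (n := n) (k := 0) (N := n + 2) y (by omega)]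
  rw [Finset.sum_range_succ', Finset.sum_range_succ' _ (n + 1)]
  simp only [ballotTerm_succ_zero, ballotSum, Finset.mul_sum, mul_add, Finset.sum_add_distrib,
    pow_succ]
  simp only [mul_assoc, mul_left_comm y]
  simp [ballotTerm, choosePred]
  ring

theorem ballotSum_succ_succ {K : Type*} [Field K] (y : K) (n k : ℕ) :
    ballotSum y (n + 1) (k + 1) = ballotSum y n k + (1 + y) * ballotSum y n (k + 1)
      + y * ballotSum y n (k + 2) := by
  rw [add_mul, one_mul, ballotSum,
    ballotSum_eq_sum_range (n := n) (k := k) (N := n + 2) y (by omega)]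
  nth_rewrite 1 [ballotSum_eq_sum_range (n := n) (k := k + 1) (N := n + 2) y (by omega)]
  rw [Finset.sum_range_succ', Finset.sum_range_succ' _ (n + 1), Finset.sum_range_succ' _ (n + 1)]
  simp only [ballotTerm_succ_succ, ballotSum, Finset.mul_sum, mul_add, Finset.sum_add_distrib,
    pow_succ]
  simp only [mul_assoc, mul_left_comm y]
  simp [ballotTerm, choosePred, Nat.choose_succ_succ]
  ring

/-- Summation by parts: the step operator on the ballot numbers is moved onto its transpose acting
on `c`. -/
theorem sum_ballotSum_succ {K : Type*} [Field K] (y : K) (n : ℕ) (c : ℕ → K) :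
    ∑ k ∈ Finset.range (n + 2), ballotSum y (n + 1) k * c k
      = ballotSum y n 0 * (c 1 + (1 + y) * c 0)
        + ∑ k ∈ Finset.range n, ballotSum y n (k + 1)
          * (c (k + 2) + (1 + y) * c (k + 1) + y * c k) := by
  have z1 : ballotSum y n (n + 1) = 0 := ballotSum_eq_zero y (by omega)
  have z2 : ballotSum y n (n + 2) = 0 := ballotSum_eq_zero y (by omega)
  have e1 : ∑ k ∈ Finset.range (n + 1), ballotSum y n k * c (k + 1)
      = ∑ k ∈ Finset.range n, ballotSum y n (k + 1) * c (k + 2) + ballotSum y n 0 * c 1 :=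
    Finset.sum_range_succ' _ _
  have e2 : ∑ k ∈ Finset.range (n + 1), ballotSum y n (k + 1) * c (k + 1)
      = ∑ k ∈ Finset.range n, ballotSum y n (k + 1) * c (k + 1) := by
    rw [Finset.sum_range_succ, z1]; simp
  -- Both sides extend to a range of length `n + 2`, since the ballot numbers vanish above height
  -- `n`; the first term is then split off.
  have e3 : ∑ k ∈ Finset.range n, ballotSum y n (k + 1) * c k = ballotSum y n 1 * c 0
      + ∑ k ∈ Finset.range (n + 1), ballotSum y n (k + 2) * c (k + 1) := by
    have a1 := Finset.sum_range_succ' (fun k => ballotSum y n (k + 1) * c k) (n + 1)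
    have a2 := Finset.sum_range_succ (fun k => ballotSum y n (k + 1) * c k) (n + 1)
    have a3 := Finset.sum_range_succ (fun k => ballotSum y n (k + 1) * c k) n
    simp only [z1, z2] at a1 a2 a3
    linear_combination a1 - a2 - a3
  rw [Finset.sum_range_succ']
  simp only [ballotSum_succ_succ, ballotSum_succ_zero, add_mul, mul_add, Finset.sum_add_distrib]
  rw [e1]
  simp only [mul_assoc, one_mul, mul_left_comm (ballotSum y n _) y, ← Finset.mul_sum]
  rw [e2, e3]
  ring

/-! ### Comparison of the two Motzkin tables -/

theorem one_sub_mul_qInt {K : Type*} [Field K] (q : K) (n : ℕ) :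
    (1 - q) * qInt q n = 1 - q ^ n := by
  unfold qInt
  induction n with
  | zero => simp
  | succ n ih => rw [Finset.sum_range_succ, mul_add, ih]; ring

/-- Both sides obey the same recurrence in `n`: the constant-weight operator acting on `connCoeff`
in `k` equals the rescaled `q`-Laguerre operator acting in `h`. -/
theorem pow_mul_motzkinTable {K : Type*} [Field K] (y q : K) (n h : ℕ) :
    (1 - q) ^ n * motzkinTable (fun h => qInt q h + y * qInt q (h + 1))
        (fun h => y * qInt q h ^ 2) n h
      = (1 - q) ^ h * ∑ k ∈ Finset.range (n + 1), ballotSum y n k * connCoeff y q k h := by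
  induction n generalizing h with
  | zero =>
    cases h with
    | zero => simp [motzkinTable, connCoeff_self, ballotSum, ballotTerm, choosePred]
    | succ h => simp [motzkinTable, connCoeff_of_lt]
  | succ n ih =>
    rw [sum_ballotSum_succ]
    cases h with
    | zero =>
      have e : ∀ k, connCoeff y q (k + 2) 0 + (1 + y) * connCoeff y q (k + 1) 0
          + y * connCoeff y q k 0 = (y - y * q) * connCoeff y q (k + 1) 0
          + y * (1 - q) ^ 2 * connCoeff y q (k + 1) 1 := by
        intro k; rw [connCoeff_succ_zero]; ring
      have h0 := ih 0
      have h1 := ih 1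
      rw [Finset.sum_range_succ'] at h0 h1
      simp only [connCoeff_self, connCoeff_of_lt y q (Nat.zero_lt_one)] at h0 h1
      rw [motzkinTable]
      simp only [e, connCoeff_one_zero, connCoeff_self, mul_add, Finset.sum_add_distrib,
        mul_left_comm (ballotSum y n _), ← Finset.mul_sum]
      simp only [show qInt q 0 = 0 by simp [qInt], show qInt q 1 = 1 by simp [qInt]]
      simp only [zero_add]
      linear_combination (1 - q) * y * h0 + (1 - q) * y * h1
    | succ h =>
      have e : ∀ k, connCoeff y q (k + 2) (h + 1) + (1 + y) * connCoeff y q (k + 1) (h + 1)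
          + y * connCoeff y q k (h + 1) = connCoeff y q (k + 1) h
          + (1 + y - q ^ (h + 1) * (1 + y * q)) * connCoeff y q (k + 1) (h + 1)
          + y * (1 - q ^ (h + 2)) ^ 2 * connCoeff y q (k + 1) (h + 2) := by
        intro k; rw [connCoeff_succ_succ]; ring
      have h0 := ih h
      have h1 := ih (h + 1)
      have h2 := ih (h + 2)
      rw [Finset.sum_range_succ'] at h0 h1 h2
      have q1 := one_sub_mul_qInt q (h + 1)
      have q2 := one_sub_mul_qInt q (h + 2)
      rw [motzkinTable]
      simp only [e, connCoeff_one_succ, mul_add, Finset.sum_add_distrib,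
        mul_left_comm (ballotSum y n _), ← Finset.mul_sum]
      rw [← q2, show q ^ (h + 1) * 1 + q ^ (h + 1) * (y * q) = 1 - (1 - q) * qInt q (h + 1)
        + y * (1 - (1 - q) * qInt q (h + 2)) by rw [q1, q2]; ring]
      linear_combination (1 - q) * h0 + (1 - q) * (qInt q (h + 1) + y * qInt q (h + 2)) * h1
        + (1 - q) * y * qInt q (h + 2) ^ 2 * h2

/-! ### Rook placements and their growth -/

/-- The placements of `k` non-attacking rooks on the board with `a` rows and `b` columns. -/
def rookPlacements (a b k : ℕ) : Finset (Finset (ℕ × ℕ)) :=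
  ((Finset.range a ×ˢ Finset.range b).powersetCard k).filter fun A =>
    ∀ x ∈ A, ∀ z ∈ A, x.1 = z.1 ∨ x.2 = z.2 → x = z

theorem mem_rookPlacements {a b k : ℕ} {A : Finset (ℕ × ℕ)} :
    A ∈ rookPlacements a b k ↔ ((∀ x ∈ A, x.1 < a ∧ x.2 < b) ∧ A.card = k) ∧
      ∀ x ∈ A, ∀ z ∈ A, x.1 = z.1 ∨ x.2 = z.2 → x = z := by
  simp [rookPlacements, Finset.mem_powersetCard, Finset.subset_iff]

theorem image_swap_mem_rookPlacements {a b k : ℕ} {A : Finset (ℕ × ℕ)}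
    (hA : A ∈ rookPlacements a b k) : A.image Prod.swap ∈ rookPlacements b a k := by
  rw [mem_rookPlacements] at hA ⊢
  obtain ⟨⟨h1, h2⟩, h3⟩ := hA
  refine ⟨⟨?_, by rw [Finset.card_image_of_injective _ Prod.swap_injective, h2]⟩, ?_⟩
  · simp only [Finset.mem_image]
    rintro _ ⟨x, hx, rfl⟩
    exact (h1 x hx).symm
  · simp only [Finset.mem_image]
    rintro _ ⟨x, hx, rfl⟩ _ ⟨z, hz, rfl⟩ h
    rw [h3 x hx z hz h.symm]

theorem sum_rookPlacements_swap {M : Type*} [AddCommMonoid M] (a b k : ℕ)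
    (F : Finset (ℕ × ℕ) → M) : ∑ A ∈ rookPlacements a b k, F A
      = ∑ A ∈ rookPlacements b a k, F (A.image Prod.swap) := by
  have hs : ∀ A : Finset (ℕ × ℕ), (A.image Prod.swap).image Prod.swap = A := fun A => by
    rw [Finset.image_image]; simp
  refine Finset.sum_bij' (fun A _ => A.image Prod.swap) (fun A _ => A.image Prod.swap)
    (fun A hA => image_swap_mem_rookPlacements hA) (fun A hA => image_swap_mem_rookPlacements hA)
    (fun A _ => hs A) (fun A _ => hs A) (fun A _ => by rw [hs])

/-- The rows below `a` that contain no rook of `A`. -/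
def openRows (a : ℕ) (A : Finset (ℕ × ℕ)) : Finset ℕ := Finset.range a \ A.image Prod.fst

/-- The columns below `b` that contain no rook of `A`. -/
def openCols (b : ℕ) (A : Finset (ℕ × ℕ)) : Finset ℕ := Finset.range b \ A.image Prod.snd

theorem mem_openRows {a i : ℕ} {A : Finset (ℕ × ℕ)} :
    i ∈ openRows a A ↔ i < a ∧ ∀ x ∈ A, x.1 ≠ i := by
  simp only [openRows, Finset.mem_sdiff, Finset.mem_range, Finset.mem_image, not_exists, not_and]

theorem mem_openCols {b j : ℕ} {A : Finset (ℕ × ℕ)} :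
    j ∈ openCols b A ↔ j < b ∧ ∀ x ∈ A, x.2 ≠ j := by
  simp only [openCols, Finset.mem_sdiff, Finset.mem_range, Finset.mem_image, not_exists, not_and]

theorem openRows_image_swap (a : ℕ) (A : Finset (ℕ × ℕ)) :
    openRows a (A.image Prod.swap) = openCols a A := by
  simp [openRows, openCols, Finset.image_image, Function.comp_def]

theorem card_openRows {a b k : ℕ} {A : Finset (ℕ × ℕ)} (hA : A ∈ rookPlacements a b k) :
    (openRows a A).card = a - k := by
  rw [mem_rookPlacements] at hA
  obtain ⟨⟨h1, h2⟩, h3⟩ := hA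
  rw [openRows, Finset.card_sdiff_of_subset, Finset.card_image_of_injOn, h2, Finset.card_range]
  · exact fun x hx z hz h => h3 x hx z hz (Or.inl h)
  · simp only [Finset.image_subset_iff, Finset.mem_range]
    exact fun x hx => (h1 x hx).1

theorem card_openCols {a b k : ℕ} {A : Finset (ℕ × ℕ)} (hA : A ∈ rookPlacements a b k) :
    (openCols b A).card = b - k := by
  rw [← openRows_image_swap, card_openRows (image_swap_mem_rookPlacements hA)]

theorem insert_mem_rookPlacements {a b k i : ℕ} {A : Finset (ℕ × ℕ)}
    (hA : A ∈ rookPlacements a b k) (hi : i ∈ openRows a A) :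
    insert (i, b) A ∈ rookPlacements a (b + 1) (k + 1) := by
  rw [mem_rookPlacements] at hA ⊢
  rw [mem_openRows] at hi
  obtain ⟨⟨h1, h2⟩, h3⟩ := hA
  refine ⟨⟨?_, ?_⟩, ?_⟩
  · intro x hx
    rcases Finset.mem_insert.1 hx with rfl | hx
    · exact ⟨hi.1, Nat.lt_succ_self b⟩
    · exact ⟨(h1 x hx).1, Nat.lt_succ_of_lt (h1 x hx).2⟩
  · rw [Finset.card_insert_of_notMem, h2]
    exact fun h => hi.2 _ h rfl
  · intro x hx z hz h
    rcases Finset.mem_insert.1 hx with rfl | hx <;> rcases Finset.mem_insert.1 hz with rfl | hz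
    · rfl
    · rcases h with h | h
      · exact absurd h.symm (hi.2 z hz)
      · exact absurd h.symm (h1 z hz).2.ne
    · rcases h with h | h
      · exact absurd h (hi.2 x hx)
      · exact absurd h (h1 x hx).2.ne
    · exact h3 x hx z hz h

theorem sum_rookPlacements_add_col {M : Type*} [AddCommMonoid M] (a b k : ℕ)
    (F : Finset (ℕ × ℕ) → M) : ∑ A ∈ rookPlacements a (b + 1) (k + 1), F A
      = ∑ A ∈ rookPlacements a b (k + 1), F A
        + ∑ A ∈ rookPlacements a b k, ∑ i ∈ openRows a A, F (insert (i, b) A) := by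
  rw [← Finset.sum_filter_add_sum_filter_not (rookPlacements a (b + 1) (k + 1))
    (fun A => ∀ x ∈ A, x.2 ≠ b)]
  congr 1
  · refine Finset.sum_congr ?_ fun _ _ => rfl
    ext A
    rw [Finset.mem_filter, mem_rookPlacements, mem_rookPlacements]
    constructor
    · rintro ⟨⟨⟨h1, h2⟩, h3⟩, h4⟩
      exact ⟨⟨fun x hx => ⟨(h1 x hx).1, by have := (h1 x hx).2; have := h4 x hx; omega⟩, h2⟩, h3⟩
    · rintro ⟨⟨h1, h2⟩, h3⟩
      exact ⟨⟨⟨fun x hx => ⟨(h1 x hx).1, Nat.lt_succ_of_lt (h1 x hx).2⟩, h2⟩, h3⟩,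
        fun x hx => (h1 x hx).2.ne⟩
  · rw [Finset.sum_sigma']
    symm
    refine Finset.sum_bij (fun p _ => insert (p.2, b) p.1) ?_ ?_ ?_ fun _ _ => rfl
    · rintro ⟨A, i⟩ h
      rw [Finset.mem_sigma] at h
      rw [Finset.mem_filter]
      refine ⟨insert_mem_rookPlacements h.1 h.2, fun h' => ?_⟩
      exact h' _ (Finset.mem_insert_self _ _) rfl
    · rintro ⟨A, i⟩ h ⟨A', i'⟩ h' e
      rw [Finset.mem_sigma] at h h'
      simp only at h h' e
      -- The old placement is recovered by discarding column `b`.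
      have key : ∀ (B : Finset (ℕ × ℕ)) (l : ℕ), B ∈ rookPlacements a b k →
          (l, b) ∉ B ∧ (insert (l, b) B).filter (fun x => x.2 ≠ b) = B := by
        intro B l hB
        have hB' : ∀ x ∈ B, x.2 ≠ b := fun x hx => ((mem_rookPlacements.1 hB).1.1 x hx).2.ne
        refine ⟨fun h => hB' _ h rfl, ?_⟩
        rw [Finset.filter_insert, if_neg (by simp), Finset.filter_true_of_mem hB']
      have hAA : A = A' := by
        rw [← (key A i h.1).2, e, (key A' i' h'.1).2]
      subst hAA
      have hmem : (i, b) ∈ insert (i', b) A := e ▸ Finset.mem_insert_self _ _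
      rcases Finset.mem_insert.1 hmem with h1 | h1
      · rw [(Prod.mk.inj h1).1]
      · exact absurd h1 (key A i h.1).1
    · intro B hB
      rw [Finset.mem_filter, mem_rookPlacements] at hB
      obtain ⟨⟨⟨h1, h2⟩, h3⟩, h4⟩ := hB
      push Not at h4
      obtain ⟨⟨i, c⟩, hx, hc⟩ := h4
      simp only at hc
      subst hc
      refine ⟨⟨B.erase (i, c), i⟩, ?_, Finset.insert_erase hx⟩
      rw [Finset.mem_sigma, mem_rookPlacements, mem_openRows]
      refine ⟨⟨⟨fun x hx' => ?_, by rw [Finset.card_erase_of_mem hx, h2]; rfl⟩, fun x hx z hz =>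
        h3 x (Finset.mem_of_mem_erase hx) z (Finset.mem_of_mem_erase hz)⟩, (h1 _ hx).1, ?_⟩
      · have hB := Finset.mem_of_mem_erase hx'
        refine ⟨(h1 x hB).1, lt_of_le_of_ne (Nat.lt_succ_iff.1 (h1 x hB).2) fun h => ?_⟩
        exact Finset.ne_of_mem_erase hx' (h3 x hB _ hx (Or.inr h))
      · intro x hx' h
        exact Finset.ne_of_mem_erase hx' (h3 x (Finset.mem_of_mem_erase hx') _ hx (Or.inl h))

theorem sum_rookPlacements_add_row {M : Type*} [AddCommMonoid M] (a b k : ℕ)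
    (F : Finset (ℕ × ℕ) → M) : ∑ A ∈ rookPlacements (a + 1) b (k + 1), F A
      = ∑ A ∈ rookPlacements a b (k + 1), F A
        + ∑ A ∈ rookPlacements a b k, ∑ j ∈ openCols b A, F (insert (a, j) A) := by
  rw [sum_rookPlacements_swap, sum_rookPlacements_add_col, sum_rookPlacements_swap a b (k + 1),
    sum_rookPlacements_swap a b k]
  congr 1
  refine Finset.sum_congr rfl fun A _ => ?_
  have : openCols b (A.image Prod.swap) = openRows b A := by
    rw [← openRows_image_swap, Finset.image_image]; simp
  rw [this]
  refine Finset.sum_congr rfl fun i _ => ?_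
  rw [Finset.image_insert, Prod.swap_prod_mk]

/-! ### Crossing weights -/

/-- The weight of the rook `x` in `A`: a factor `y` for a weak exceedance, and a factor `q` for
every crossing that the arc of `x` forms with an arc which is completed later. -/
def rookWeight {K : Type*} [Field K] (y q : K) (A : Finset (ℕ × ℕ)) (x : ℕ × ℕ) : K :=
  if x.1 ≤ x.2 then
    y * q ^ ((Finset.Ioc x.1 x.2).filter fun k => ∀ l ≤ x.2, (k, l) ∉ A).card
  else q ^ ((Finset.Ioo x.2 x.1).filter fun c => ∀ l ≤ x.1, (l, c) ∉ A).card

/-- The weight of a rook placement. -/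
def placementWeight {K : Type*} [Field K] (y q : K) (A : Finset (ℕ × ℕ)) : K :=
  ∏ x ∈ A, rookWeight y q A x

/-- The numbers of larger elements run through `0, …, |S| - 1`, once each. -/
theorem sum_pow_card_filter_lt {K : Type*} [Field K] (q : K) (S : Finset ℕ) :
    ∑ i ∈ S, q ^ (S.filter fun k => i < k).card = qInt q S.card := by
  induction S using Finset.induction_on_min with
  | empty => simp [qInt]
  | insert m S hm ih =>
    have hmS : m ∉ S := fun h => (hm m h).false
    rw [Finset.sum_insert hmS, Finset.card_insert_of_notMem hmS, qInt, Finset.sum_range_succ,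
      ← qInt, ← ih, Finset.filter_insert, if_neg (lt_irrefl m), Finset.filter_true_of_mem hm,
      add_comm]
    congr 1
    refine Finset.sum_congr rfl fun i hi => ?_
    rw [Finset.filter_insert, if_neg (hm i hi).not_gt]

/-- The conditions `l ≤ x.2` and `l ≤ x.1` in `rookWeight` ignore later rooks, so old weights do not
change. The new rook in row `i` crosses exactly the arcs that will leave the open rows above `i`. -/
theorem placementWeight_insert_col {K : Type*} [Field K] (y q : K) {b k i : ℕ}
    {A : Finset (ℕ × ℕ)} (hA : A ∈ rookPlacements (b + 1) b k) (hi : i ∈ openRows (b + 1) A) :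
    placementWeight y q (insert (i, b) A)
      = y * q ^ ((openRows (b + 1) A).filter fun k => i < k).card * placementWeight y q A := by
  have h1 := (mem_rookPlacements.1 hA).1.1
  rw [mem_openRows] at hi
  rw [placementWeight, Finset.prod_insert fun h => hi.2 _ h rfl]
  congr 1
  · rw [rookWeight, if_pos (Nat.lt_succ_iff.1 hi.1)]
    congr 3
    ext c
    simp only [Finset.mem_filter, Finset.mem_Ioc, mem_openRows, Finset.mem_insert, Prod.mk.injEq,
      not_or, Prod.forall]
    constructor
    · rintro ⟨⟨h2, h3⟩, h4⟩
      refine ⟨⟨by omega, fun c' l hcl e => ?_⟩, h2⟩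
      subst e
      exact (h4 l (h1 _ hcl).2.le).2 hcl
    · rintro ⟨⟨h2, h3⟩, h4⟩
      exact ⟨⟨h4, by omega⟩, fun l _ => ⟨by omega, fun h => h3 c l h rfl⟩⟩
  · refine Finset.prod_congr rfl fun x hx => ?_
    have hx1 := h1 x hx
    unfold rookWeight
    congr 3
    · refine congrArg Finset.card ?_
      apply Finset.filter_congr
      intro c _
      refine forall₂_congr fun l hl => ?_
      rw [Finset.mem_insert, Prod.mk.injEq, or_iff_right (by omega)]
    · apply Finset.filter_congr
      intro c hc
      refine forall₂_congr fun l hl => ?_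
      rw [Finset.mem_Ioo] at hc
      rw [Finset.mem_insert, Prod.mk.injEq, or_iff_right (by omega)]

theorem placementWeight_insert_row {K : Type*} [Field K] (y q : K) {a k j : ℕ}
    {A : Finset (ℕ × ℕ)} (hA : A ∈ rookPlacements a a k) (hj : j ∈ openCols a A) :
    placementWeight y q (insert (a, j) A)
      = q ^ ((openCols a A).filter fun k => j < k).card * placementWeight y q A := by
  have h1 := (mem_rookPlacements.1 hA).1.1
  rw [mem_openCols] at hj
  rw [placementWeight, Finset.prod_insert fun h => hj.2 _ h rfl]
  congr 1
  · rw [rookWeight, if_neg (by simpa using hj.1)]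
    congr 2
    ext c
    simp only [Finset.mem_filter, Finset.mem_Ioo, mem_openCols, Finset.mem_insert, Prod.mk.injEq,
      not_or, Prod.forall]
    constructor
    · rintro ⟨⟨h2, h3⟩, h4⟩
      refine ⟨⟨by omega, fun l c' hcl e => ?_⟩, h2⟩
      subst e
      exact (h4 l (h1 _ hcl).1.le).2 hcl
    · rintro ⟨⟨h2, h3⟩, h4⟩
      exact ⟨⟨h4, by omega⟩, fun l _ => ⟨by omega, fun h => h3 l c h rfl⟩⟩
  · refine Finset.prod_congr rfl fun x hx => ?_
    have hx1 := h1 x hx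
    unfold rookWeight
    congr 3
    · refine congrArg Finset.card ?_
      apply Finset.filter_congr
      intro c hc
      refine forall₂_congr fun l hl => ?_
      rw [Finset.mem_Ioc] at hc
      rw [Finset.mem_insert, Prod.mk.injEq, or_iff_right (by omega)]
    · apply Finset.filter_congr
      intro c hc
      refine forall₂_congr fun l hl => ?_
      rw [Finset.mem_insert, Prod.mk.injEq, or_iff_right (by omega)]

/-- The weighted count of placements of `k` rooks on the board with `a` rows and `b` columns. -/
def rookSum {K : Type*} [Field K] (y q : K) (a b k : ℕ) : K :=
  ∑ A ∈ rookPlacements a b k, placementWeight y q A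

theorem rookSum_add_col {K : Type*} [Field K] (y q : K) (b k : ℕ) :
    rookSum y q (b + 1) (b + 1) (k + 1) = rookSum y q (b + 1) b (k + 1)
      + y * qInt q (b + 1 - k) * rookSum y q (b + 1) b k := by
  rw [rookSum, sum_rookPlacements_add_col, rookSum, rookSum, Finset.mul_sum]
  congr 1
  refine Finset.sum_congr rfl fun A hA => ?_
  rw [Finset.sum_congr rfl fun i hi => placementWeight_insert_col y q hA hi, ← Finset.sum_mul,
    ← Finset.mul_sum, sum_pow_card_filter_lt, card_openRows hA]

theorem rookSum_add_row {K : Type*} [Field K] (y q : K) (a k : ℕ) :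
    rookSum y q (a + 1) a (k + 1) = rookSum y q a a (k + 1)
      + qInt q (a - k) * rookSum y q a a k := by
  rw [rookSum, sum_rookPlacements_add_row, rookSum, rookSum, Finset.mul_sum]
  congr 1
  refine Finset.sum_congr rfl fun A hA => ?_
  rw [Finset.sum_congr rfl fun i hi => placementWeight_insert_row y q hA hi, ← Finset.sum_mul,
    sum_pow_card_filter_lt, card_openCols hA]

theorem rookSum_zero {K : Type*} [Field K] (y q : K) (a b : ℕ) : rookSum y q a b 0 = 1 := by
  simp [rookSum, rookPlacements, Finset.filter_singleton, placementWeight]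

theorem rookSum_eq_zero {K : Type*} [Field K] (y q : K) {a b k : ℕ} (h : a < k) :
    rookSum y q a b k = 0 := by
  refine Finset.sum_eq_zero fun A hA => absurd h ?_
  rw [mem_rookPlacements] at hA
  obtain ⟨⟨h1, h2⟩, h3⟩ := hA
  rw [not_lt, ← h2, ← Finset.card_image_of_injOn
    (fun x hx z hz h => h3 x hx z hz (Or.inl h) : Set.InjOn Prod.fst (A : Set (ℕ × ℕ)))]
  calc _ ≤ (Finset.range a).card := Finset.card_le_card (by
        simp only [Finset.image_subset_iff, Finset.mem_range]
        exact fun x hx => (h1 x hx).1)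
    _ = a := Finset.card_range a

/-- Enlarging the board by a row and a column is one Motzkin step of the number `h` of open rows: no
new rook is an up step, one is a level step, two are a down step. -/
theorem rookSum_eq_motzkinTable {K : Type*} [Field K] (y q : K) (h k : ℕ) :
    rookSum y q (h + k) (h + k) k
      = motzkinTable (fun h => qInt q h + y * qInt q (h + 1)) (fun h => y * qInt q h ^ 2)
        (h + k) h := by
  obtain ⟨n, hn⟩ : ∃ n, h + k = n := ⟨_, rfl⟩
  rw [hn]
  induction n generalizing h k with
  | zero =>
    obtain ⟨rfl, rfl⟩ : h = 0 ∧ k = 0 := by omega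
    rw [rookSum_zero, motzkinTable]
  | succ n ih =>
    have hS : ∀ k ≤ n, rookSum y q n n k = motzkinTable (fun h => qInt q h + y * qInt q (h + 1))
        (fun h => y * qInt q h ^ 2) n (n - k) := fun k hk => ih _ _ (by omega)
    cases k with
    | zero =>
      obtain rfl : h = n + 1 := by omega
      rw [rookSum_zero, motzkinTable, motzkinTable_eq_zero _ _ _ _ (Nat.lt_succ_self n),
        motzkinTable_eq_zero _ _ _ _ (by omega : n < n + 2), ← Nat.sub_zero n, Nat.sub_zero,
        ← ih n 0 rfl, rookSum_zero]
      ring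
    | succ k =>
      -- The intermediate board, with `n + 1` rows and `n` columns.
      have hrow : rookSum y q (n + 1) n k = motzkinTable (fun h => qInt q h + y * qInt q (h + 1))
          (fun h => y * qInt q h ^ 2) n h + qInt q (h + 1) * motzkinTable
          (fun h => qInt q h + y * qInt q (h + 1)) (fun h => y * qInt q h ^ 2) n (h + 1) := by
        rw [← ih h k (by omega)]
        cases k with
        | zero => rw [rookSum_zero, rookSum_zero, motzkinTable_eq_zero _ _ _ _ (by omega)]; ring
        | succ k => rw [rookSum_add_row, ih (h + 1) k (by omega), show n - k = h + 1 by omega]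
      rw [rookSum_add_col, hrow, rookSum_add_row, show n - k = h by omega,
        show n + 1 - k = h + 1 by omega, ih h k (by omega)]
      -- At `h = 0` there is no up step: `k + 1` rooks do not fit on `n = k` rows, and `[0] = 0`.
      cases h with
      | zero =>
        rw [rookSum_eq_zero y q (by omega : n < k + 1), motzkinTable]
        simp only [show qInt q 0 = 0 by simp [qInt]]
        ring
      | succ h =>
        rw [ih h (k + 1) (by omega), motzkinTable]
        ring

/-! ### Permutations as full placements -/

/-- The graph of a permutation, as a rook placement. -/
def permGraph {n : ℕ} (σ : Equiv.Perm (Fin n)) : Finset (ℕ × ℕ) :=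
  Finset.univ.image fun i : Fin n => ((i : ℕ), (σ i : ℕ))

theorem mem_permGraph {n : ℕ} {σ : Equiv.Perm (Fin n)} {x : ℕ × ℕ} :
    x ∈ permGraph σ ↔ ∃ i : Fin n, ((i : ℕ), (σ i : ℕ)) = x := by
  simp [permGraph]

theorem mk_mem_permGraph {n : ℕ} {σ : Equiv.Perm (Fin n)} {i l : Fin n} :
    ((i : ℕ), (l : ℕ)) ∈ permGraph σ ↔ σ i = l := by
  rw [mem_permGraph]
  constructor
  · rintro ⟨i', h⟩
    obtain ⟨h1, h2⟩ := Prod.mk.inj h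
    rw [← Fin.ext h1, Fin.ext h2]
  · rintro rfl
    exact ⟨i, rfl⟩

theorem permGraph_mem_rookPlacements {n : ℕ} (σ : Equiv.Perm (Fin n)) :
    permGraph σ ∈ rookPlacements n n n := by
  rw [mem_rookPlacements]
  refine ⟨⟨?_, ?_⟩, ?_⟩
  · intro x hx
    obtain ⟨i, rfl⟩ := mem_permGraph.1 hx
    exact ⟨i.2, (σ i).2⟩
  · rw [permGraph, Finset.card_image_of_injective, Finset.card_univ, Fintype.card_fin]
    exact fun i j h => Fin.ext (Prod.mk.inj h).1
  · intro x hx z hz h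
    obtain ⟨i, rfl⟩ := mem_permGraph.1 hx
    obtain ⟨j, rfl⟩ := mem_permGraph.1 hz
    rcases h with h | h
    · rw [Fin.ext h]
    · rw [σ.injective (Fin.ext h)]

theorem permGraph_injective (n : ℕ) :
    Function.Injective (permGraph : Equiv.Perm (Fin n) → Finset (ℕ × ℕ)) := by
  intro σ τ h
  ext i
  have : ((i : ℕ), (σ i : ℕ)) ∈ permGraph τ := h ▸ mk_mem_permGraph.2 rfl
  rw [mk_mem_permGraph.1 this]

theorem exists_permGraph_eq {n : ℕ} {A : Finset (ℕ × ℕ)} (hA : A ∈ rookPlacements n n n) :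
    ∃ σ : Equiv.Perm (Fin n), permGraph σ = A := by
  have hc : openRows n A = ∅ := by
    rw [← Finset.card_eq_zero, card_openRows hA, Nat.sub_self]
  rw [mem_rookPlacements] at hA
  obtain ⟨⟨h1, h2⟩, h3⟩ := hA
  have hex : ∀ i : Fin n, ∃ j : Fin n, ((i : ℕ), (j : ℕ)) ∈ A := by
    intro i
    by_contra! hcon
    have : (i : ℕ) ∈ openRows n A := by
      rw [mem_openRows]
      refine ⟨i.2, ?_⟩
      rintro ⟨i', j⟩ hx rfl
      exact hcon ⟨j, (h1 _ hx).2⟩ hx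
    rw [hc] at this
    exact absurd this (Finset.notMem_empty _)
  choose f hf using hex
  have hinj : Function.Injective f := by
    intro i j hij
    have hi := hf i
    rw [hij] at hi
    exact Fin.ext (Prod.mk.inj (h3 _ hi _ (hf j) (Or.inr rfl))).1
  refine ⟨Equiv.ofBijective f (Finite.injective_iff_bijective.1 hinj), ?_⟩
  refine Finset.eq_of_subset_of_card_le ?_ ?_
  · intro x hx
    obtain ⟨i, rfl⟩ := mem_permGraph.1 hx
    exact hf i
  · rw [h2]
    exact (mem_rookPlacements.1 (permGraph_mem_rookPlacements _)).1.2.ge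

/-- In a full placement, having no rook with `l ≤ σ i` (or `l ≤ i`) means that the rook lies beyond,
so each crossing `(i, k)` is charged to its first index `i`. -/
theorem rookWeight_permGraph {K : Type*} [Field K] (y q : K) {n : ℕ} (σ : Equiv.Perm (Fin n))
    (i : Fin n) : rookWeight y q (permGraph σ) ((i : ℕ), (σ i : ℕ))
      = (if i ≤ σ i then y else 1) * q ^ (Finset.univ.filter fun k : Fin n =>
        (i < k ∧ k ≤ σ i ∧ σ i < σ k) ∨ (σ i < σ k ∧ σ k < i ∧ i < k)).card := by
  unfold rookWeight
  simp only [Fin.val_fin_le]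
  split_ifs with hi
  · congr 2
    symm
    refine Finset.card_bij (fun k _ => (k : ℕ)) ?_ (fun _ _ _ _ h => Fin.ext h) ?_
    · intro k hk
      simp only [Finset.mem_filter, Finset.mem_univ, true_and, Finset.mem_Ioc] at hk ⊢
      have hk' : i < k ∧ k ≤ σ i ∧ σ i < σ k := by
        rcases hk with hk | hk
        · exact hk
        · exact absurd (hk.1.trans hk.2.1) hi.not_gt
      refine ⟨⟨hk'.1, hk'.2.1⟩, fun l hl hmem => ?_⟩
      have := (mk_mem_permGraph (σ := σ) (i := k) (l := ⟨l, by omega⟩)).1 hmem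
      have h3 : ((σ k : Fin n) : ℕ) = l := by rw [this]
      have := Fin.lt_def.1 hk'.2.2
      omega
    · intro k hk
      simp only [Finset.mem_filter, Finset.mem_Ioc] at hk
      refine ⟨⟨k, by omega⟩, ?_, rfl⟩
      simp only [Finset.mem_filter, Finset.mem_univ, true_and]
      refine Or.inl ⟨Fin.lt_def.2 hk.1.1, Fin.le_def.2 hk.1.2, ?_⟩
      by_contra hcon
      exact hk.2 _ (Fin.le_def.1 (not_lt.1 hcon)) (mk_mem_permGraph.2 rfl :
        (((⟨k, by omega⟩ : Fin n) : ℕ), _) ∈ permGraph σ)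
  · rw [one_mul]
    congr 1
    symm
    rw [not_le] at hi
    -- Below the diagonal `rookWeight` counts columns, so `k` corresponds to `σ k`.
    refine Finset.card_bij (fun k _ => (σ k : ℕ)) ?_
      (fun _ _ _ _ h => σ.injective (Fin.ext h)) ?_
    · intro k hk
      simp only [Finset.mem_filter, Finset.mem_univ, true_and, Finset.mem_Ioo] at hk ⊢
      have hk' : σ i < σ k ∧ σ k < i ∧ i < k := by
        rcases hk with hk | hk
        · exact absurd (hk.1.trans_le hk.2.1) hi.not_gt
        · exact hk
      refine ⟨⟨hk'.1, hk'.2.1⟩, fun l hl hmem => ?_⟩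
      have := σ.injective ((mk_mem_permGraph (σ := σ) (i := ⟨l, by omega⟩) (l := σ k)).1 hmem)
      have h3 : (k : ℕ) = l := by rw [← this]
      have := Fin.lt_def.1 hk'.2.2
      omega
    · intro c hc
      simp only [Finset.mem_filter, Finset.mem_Ioo] at hc
      refine ⟨σ.symm ⟨c, by omega⟩, ?_, by simp⟩
      simp only [Finset.mem_filter, Finset.mem_univ, true_and, Equiv.apply_symm_apply]
      refine Or.inr ⟨Fin.lt_def.2 hc.1.1, Fin.lt_def.2 hc.1.2, ?_⟩
      by_contra hcon
      exact hc.2 _ (Fin.le_def.1 (not_lt.1 hcon)) (mk_mem_permGraph.2 (Equiv.apply_symm_apply _ _) :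
        (_, ((⟨c, by omega⟩ : Fin n) : ℕ)) ∈ permGraph σ)

theorem placementWeight_permGraph {K : Type*} [Field K] (y q : K) {n : ℕ}
    (σ : Equiv.Perm (Fin n)) : placementWeight y q (permGraph σ) = y ^ wex σ * q ^ cro σ := by
  rw [placementWeight]
  nth_rewrite 1 [permGraph]
  rw [Finset.prod_image fun i _ j _ h => Fin.ext (Prod.mk.inj h).1]
  simp only [rookWeight_permGraph]
  rw [Finset.prod_mul_distrib, Finset.prod_ite, Finset.prod_const, Finset.prod_const_one, mul_one,
    Finset.prod_pow_eq_pow_sum, wex, cro, Finset.card_filter _ (Finset.univ : Finset (Fin n × Fin n)),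
    ← Finset.univ_product_univ, Finset.sum_product]
  simp only [Finset.card_filter]

theorem rookSum_eq_sum_perm {K : Type*} [Field K] (y q : K) (n : ℕ) :
    rookSum y q n n n = ∑ σ : Equiv.Perm (Fin n), y ^ wex σ * q ^ cro σ := by
  symm
  refine Finset.sum_bij (fun σ _ => permGraph σ) (fun σ _ => permGraph_mem_rookPlacements σ)
    (fun σ _ τ _ h => permGraph_injective n h) (fun A hA => ?_)
    (fun σ _ => (placementWeight_permGraph y q σ).symm)
  obtain ⟨σ, hσ⟩ := exists_permGraph_eq hA
  exact ⟨σ, Finset.mem_univ _, hσ⟩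

theorem sum_perm_eq_motzkinTable {K : Type*} [Field K] (y q : K) (n : ℕ) :
    ∑ σ : Equiv.Perm (Fin n), y ^ wex σ * q ^ cro σ
      = motzkinTable (fun h => qInt q h + y * qInt q (h + 1)) (fun h => y * qInt q h ^ 2) n 0 := by
  have := rookSum_eq_motzkinTable y q 0 n
  rw [zero_add] at this
  rw [← rookSum_eq_sum_perm, this]

/-! ### The moment functional -/

theorem X_mul_qLaguerre_zero {K : Type*} [Field K] (y q : K) :
    Polynomial.X * qLaguerre y q 0 = qLaguerre y q 1
      + Polynomial.C (qInt q 0 + y * qInt q 1) * qLaguerre y q 0 := by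
  rw [qLaguerre, qLaguerre]
  ring

theorem X_mul_qLaguerre_succ {K : Type*} [Field K] (y q : K) (n : ℕ) :
    Polynomial.X * qLaguerre y q (n + 1) = qLaguerre y q (n + 2)
      + Polynomial.C (qInt q (n + 1) + y * qInt q (n + 2)) * qLaguerre y q (n + 1)
      + Polynomial.C (y * qInt q (n + 1) ^ 2) * qLaguerre y q n := by
  rw [qLaguerre.eq_3]
  ring

theorem monic_natDegree_qLaguerre {K : Type*} [Field K] (y q : K) (n : ℕ) :
    (qLaguerre y q n).Monic ∧ (qLaguerre y q n).natDegree = n := by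
  induction n using Nat.twoStepInduction with
  | zero => simp [qLaguerre]
  | one =>
    rw [qLaguerre]
    exact ⟨Polynomial.monic_X_sub_C _, Polynomial.natDegree_X_sub_C _⟩
  | more n ih0 ih1 =>
    rw [qLaguerre]
    generalize qInt q (n + 1) + y * qInt q (n + 2) = b
    generalize y * qInt q (n + 1) ^ 2 = l
    have hm := (Polynomial.monic_X_sub_C b).mul ih1.1
    have hd : ((Polynomial.X - Polynomial.C b) * qLaguerre y q (n + 1)).natDegree = n + 2 := by
      rw [(Polynomial.monic_X_sub_C b).natDegree_mul ih1.1, Polynomial.natDegree_X_sub_C, ih1.2]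
      ring
    have hlt : (Polynomial.C l * qLaguerre y q n).natDegree
        < ((Polynomial.X - Polynomial.C b) * qLaguerre y q (n + 1)).natDegree := by
      rw [hd]
      have := Polynomial.natDegree_C_mul_le l (qLaguerre y q n)
      rw [ih0.2] at this
      omega
    exact ⟨hm.sub_of_left (Polynomial.degree_lt_degree hlt),
      (Polynomial.natDegree_sub_eq_left_of_natDegree_lt hlt).trans hd⟩

/-- The `q`-Laguerre polynomials as a basis of the polynomials. -/
noncomputable def qLaguerreBasis {K : Type*} [Field K] (y q : K) : Module.Basis ℕ K K[X] :=
  Polynomial.Sequence.basis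
    { elems' := qLaguerre y q
      degree_eq' := fun i => by
        rw [Polynomial.degree_eq_natDegree (monic_natDegree_qLaguerre y q i).1.ne_zero,
          (monic_natDegree_qLaguerre y q i).2] }
    fun i => by
      have h : (qLaguerre y q i).leadingCoeff = 1 := (monic_natDegree_qLaguerre y q i).1
      exact h ▸ isUnit_one

theorem qLaguerreBasis_apply {K : Type*} [Field K] (y q : K) (n : ℕ) :
    qLaguerreBasis y q n = qLaguerre y q n := by
  simp [qLaguerreBasis]

/-- Multiplication by `X` in the `q`-Laguerre basis is one Motzkin step, read backwards. -/
theorem X_pow_eq_sum_qLaguerre {K : Type*} [Field K] (y q : K) (n : ℕ) :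
    (Polynomial.X : K[X]) ^ n = ∑ h ∈ Finset.range (n + 1), Polynomial.C (motzkinTable
      (fun h => qInt q h + y * qInt q (h + 1)) (fun h => y * qInt q h ^ 2) n h)
        * qLaguerre y q h := by
  induction n with
  | zero => simp [motzkinTable, qLaguerre]
  | succ n ih =>
    have hz := motzkinTable_eq_zero (fun h => qInt q h + y * qInt q (h + 1))
      (fun h => y * qInt q h ^ 2) n
    generalize ht : motzkinTable (fun h => qInt q h + y * qInt q (h + 1))
      (fun h => y * qInt q h ^ 2) = t at *
    have t0 : t (n + 1) 0 = (qInt q 0 + y * qInt q 1) * t n 0 + y * qInt q 1 ^ 2 * t n 1 := by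
      rw [← ht, motzkinTable]
    have ts : ∀ h, t (n + 1) (h + 1) = t n h + (qInt q (h + 1) + y * qInt q (h + 2)) * t n (h + 1)
        + y * qInt q (h + 2) ^ 2 * t n (h + 2) := by
      intro h
      rw [← ht, motzkinTable]
    have e1 := Finset.sum_range_succ'
      (fun h => Polynomial.C (t n h) * qLaguerre y q (h + 1)) n
    have e2 : ∑ h ∈ Finset.range (n + 1), Polynomial.C (t n (h + 1))
          * (Polynomial.C (qInt q (h + 1) + y * qInt q (h + 2)) * qLaguerre y q (h + 1))
        = ∑ h ∈ Finset.range n, Polynomial.C (t n (h + 1))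
          * (Polynomial.C (qInt q (h + 1) + y * qInt q (h + 2)) * qLaguerre y q (h + 1)) := by
      rw [Finset.sum_range_succ, hz (n + 1) (by omega)]
      simp
    have e3 : ∑ h ∈ Finset.range n, Polynomial.C (t n (h + 1))
          * (Polynomial.C (y * qInt q (h + 1) ^ 2) * qLaguerre y q h)
        = Polynomial.C (t n 1) * (Polynomial.C (y * qInt q 1 ^ 2) * qLaguerre y q 0)
          + ∑ h ∈ Finset.range (n + 1), Polynomial.C (t n (h + 2))
            * (Polynomial.C (y * qInt q (h + 2) ^ 2) * qLaguerre y q (h + 1)) := by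
      have a1 := Finset.sum_range_succ' (fun h => Polynomial.C (t n (h + 1))
        * (Polynomial.C (y * qInt q (h + 1) ^ 2) * qLaguerre y q h)) (n + 1)
      have a2 := Finset.sum_range_succ (fun h => Polynomial.C (t n (h + 1))
        * (Polynomial.C (y * qInt q (h + 1) ^ 2) * qLaguerre y q h)) (n + 1)
      have a3 := Finset.sum_range_succ (fun h => Polynomial.C (t n (h + 1))
        * (Polynomial.C (y * qInt q (h + 1) ^ 2) * qLaguerre y q h)) n
      simp only [hz (n + 1) (by omega), hz (n + 1 + 1) (by omega), Polynomial.C_0, zero_mul]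
        at a1 a2 a3
      linear_combination a1 - a2 - a3
    rw [pow_succ', ih, Finset.mul_sum, Finset.sum_range_succ', Finset.sum_range_succ']
    simp only [mul_left_comm Polynomial.X, X_mul_qLaguerre_zero, X_mul_qLaguerre_succ, ts, t0]
    simp only [zero_add] at e1
    have e4 : ∀ h, Polynomial.C (t n h + (qInt q (h + 1) + y * qInt q (h + 2)) * t n (h + 1)
        + y * qInt q (h + 2) ^ 2 * t n (h + 2)) * qLaguerre y q (h + 1)
        = Polynomial.C (t n h) * qLaguerre y q (h + 1) + Polynomial.C (t n (h + 1))
          * (Polynomial.C (qInt q (h + 1) + y * qInt q (h + 2)) * qLaguerre y q (h + 1))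
          + Polynomial.C (t n (h + 2))
            * (Polynomial.C (y * qInt q (h + 2) ^ 2) * qLaguerre y q (h + 1)) := by
      intro h
      simp only [map_add, map_mul]
      ring
    simp only [e4, mul_add, Finset.sum_add_distrib]
    rw [e1, e2, e3]
    simp only [map_add, map_mul]
    ring

theorem IsMomentFunctional.apply_qLaguerre {K : Type*} [Field K] {y q : K} {ℓ : K[X] →ₗ[K] K}
    (hℓ : IsMomentFunctional (qLaguerre y q) ℓ) (n : ℕ) :
    ℓ (qLaguerre y q n) = if n = 0 then 1 else 0 := by
  split_ifs with h
  · subst h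
    exact hℓ.1
  · have := hℓ.2 0 n (Ne.symm h)
    rwa [qLaguerre, one_mul] at this

theorem IsMomentFunctional.apply_X_pow {K : Type*} [Field K] {y q : K} {ℓ : K[X] →ₗ[K] K}
    (hℓ : IsMomentFunctional (qLaguerre y q) ℓ) (n : ℕ) :
    ℓ (Polynomial.X ^ n) = motzkinTable (fun h => qInt q h + y * qInt q (h + 1))
      (fun h => y * qInt q h ^ 2) n 0 := by
  rw [X_pow_eq_sum_qLaguerre y q, map_sum, Finset.sum_eq_single_of_mem 0 (by simp)]
  · rw [← Polynomial.smul_eq_C_mul, map_smul, hℓ.apply_qLaguerre]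
    simp
  · intro h _ hh
    rw [← Polynomial.smul_eq_C_mul, map_smul, hℓ.apply_qLaguerre, if_neg hh, smul_zero]

/-- Each factor `X` lowers the index by at most one, so `k < n` factors never reach `qLaguerre y q
0`. -/
theorem apply_X_pow_mul_qLaguerre {K : Type*} [Field K] {y q : K} {ℓ : K[X] →ₗ[K] K}
    (hℓ : ∀ n, ℓ (qLaguerre y q n) = if n = 0 then 1 else 0) (k n : ℕ) (hk : k < n) :
    ℓ (Polynomial.X ^ k * qLaguerre y q n) = 0 := by
  induction k generalizing n with
  | zero => rw [pow_zero, one_mul, hℓ, if_neg (by omega)]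
  | succ k ih =>
    obtain ⟨n, rfl⟩ := Nat.exists_eq_succ_of_ne_zero (by omega : n ≠ 0)
    rw [Nat.succ_eq_add_one, pow_succ, mul_assoc, X_mul_qLaguerre_succ, mul_add, mul_add,
      mul_left_comm, mul_left_comm _ (Polynomial.C _) (qLaguerre y q n),
      ← Polynomial.smul_eq_C_mul, ← Polynomial.smul_eq_C_mul, map_add, map_add, map_smul, map_smul,
      ih _ (by omega), ih _ (by omega), ih _ (by omega)]
    simp

theorem apply_qLaguerre_mul_of_lt {K : Type*} [Field K] {y q : K} {ℓ : K[X] →ₗ[K] K}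
    (hℓ : ∀ n, ℓ (qLaguerre y q n) = if n = 0 then 1 else 0) {m n : ℕ} (h : m < n) :
    ℓ (qLaguerre y q m * qLaguerre y q n) = 0 := by
  rw [(qLaguerre y q m).as_sum_range_C_mul_X_pow, (monic_natDegree_qLaguerre y q m).2,
    Finset.sum_mul, map_sum]
  refine Finset.sum_eq_zero fun k hk => ?_
  rw [mul_assoc, ← Polynomial.smul_eq_C_mul, map_smul, apply_X_pow_mul_qLaguerre hℓ k n
    (by rw [Finset.mem_range] at hk; omega), smul_zero]

/-- Orthogonality to `L 0 = 1` fixes the values on a basis. Conversely these values force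
orthogonality, even if some `y[n]^2` vanish. -/
theorem existsUnique_isMomentFunctional_qLaguerre {K : Type*} [Field K] (y q : K) :
    ∃! ℓ : K[X] →ₗ[K] K, IsMomentFunctional (qLaguerre y q) ℓ := by
  have hex : ∀ n, (qLaguerreBasis y q).constr K (fun n => if n = 0 then (1 : K) else 0)
      (qLaguerre y q n) = if n = 0 then 1 else 0 := by
    intro n
    rw [← qLaguerreBasis_apply, Module.Basis.constr_basis]
  refine ⟨(qLaguerreBasis y q).constr K (fun n => if n = 0 then 1 else 0), ⟨hex 0, ?_⟩, ?_⟩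
  · intro m n hmn
    rcases lt_or_gt_of_ne hmn with h | h
    · exact apply_qLaguerre_mul_of_lt hex h
    · rw [mul_comm]
      exact apply_qLaguerre_mul_of_lt hex h
  · intro ℓ hℓ
    refine (qLaguerreBasis y q).ext fun n => ?_
    rw [qLaguerreBasis_apply, hex, hℓ.apply_qLaguerre]

/-! ### The closed formula -/

theorem connCoeff_zero_right {K : Type*} [Field K] (y q : K) (k : ℕ) :
    connCoeff y q k 0
      = (-1) ^ k * ∑ i ∈ Finset.range (k + 1), y ^ i * q ^ (i * (k + 1 - i)) := by
  have h := connCoeff_add y q k 0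
  rw [zero_add] at h
  rw [h, connSum, Finset.Nat.sum_antidiagonal_eq_sum_range_succ (connTerm y q 0)]
  congr 1
  refine Finset.sum_congr rfl fun i hi => ?_
  rw [Finset.mem_range] at hi
  rw [connTerm, qBinom_zero_right, qBinom_zero_right, mul_one, mul_one,
    show k - i + 1 = k + 1 - i by omega]

theorem theorem4 {K : Type*} [Field K] (y q : K) :
    (∀ n : ℕ, q ≠ 1 →
      ∑ σ : Equiv.Perm (Fin n), y ^ wex σ * q ^ cro σ =
        1 / (1 - q) ^ n *
          ∑ k ∈ Finset.range (n + 1), (-1) ^ k *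
            (∑ j ∈ Finset.range (n - k + 1), y ^ j *
              ((n.choose j : K) * (n.choose (j + k) : K) -
                (choosePred n j : K) * (n.choose (j + k + 1) : K))) *
            (∑ i ∈ Finset.range (k + 1), y ^ i * q ^ (i * (k + 1 - i)))) ∧
    (∃! ℓ : K[X] →ₗ[K] K, IsMomentFunctional (qLaguerre y q) ℓ) ∧
    (∀ ℓ : K[X] →ₗ[K] K, IsMomentFunctional (qLaguerre y q) ℓ →
      ∀ n : ℕ, ℓ (Polynomial.X ^ n) = ∑ σ : Equiv.Perm (Fin n), y ^ wex σ * q ^ cro σ) := by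
  refine ⟨fun n hq => ?_, existsUnique_isMomentFunctional_qLaguerre y q, fun ℓ hℓ n => ?_⟩
  · have hq' : (1 - q) ^ n ≠ 0 := pow_ne_zero _ (sub_ne_zero.2 hq.symm)
    have h := pow_mul_motzkinTable y q n 0
    rw [← sum_perm_eq_motzkinTable, pow_zero, one_mul] at h
    rw [one_div, eq_inv_mul_iff_mul_eq₀ hq', h]
    refine Finset.sum_congr rfl fun k hk => ?_
    rw [Finset.mem_range] at hk
    -- The terms with `j > n - k` vanish, which gives the shorter range of the statement.
    rw [connCoeff_zero_right, ballotSum_eq_sum_range y (N := n - k + 1) (by omega)]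
    simp only [ballotTerm]
    ring
  · rw [hℓ.apply_X_pow, sum_perm_eq_motzkinTable]
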